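/- Let $k\ge 0$ be even, let $d\ge 1$, $n\ge 0$, $\ell\ge 1$ be integers and let $p\in[0,1]$. \emph{Random $k$-XOR.} Each of the $n^k$ tuples $S\in[n]^k$ is sampled independently with probability $p$, and each sampled $S$ receives the constraint $\prod_{i=1}^k x_{s_i}=\eta_S$, where the $\eta_S\in\{\pm1\}$ are i.i.d. Rademacher variables, independent of the sampling; $\Phi$ is the resulting set of constraints. Let $T_S=\eta_S$ if $S$ is sampled and $T_S=0$ otherwise. \emph{The matrix.} For $U,V\in[n]^{k/2}$ put $S^\Phi_{U,V}=\frac12\big(T_{(U,V)}+T_{(V,U)}\big)$. Write $I\in[n]^{kd/2}$ as $I=(U_1,\dots,U_d)$ with blocks $U_s\in[n]^{k/2}$, and for $I=(U_1,\dots,U_d)$, $J=(V_1,\dots,V_d)$ put $S^{\Phi,d}_{I,J}=\prod_{s=1}^d S^\Phi_{U_s,V_s}$. Let $\mathbb S_{kd/2}$ be the set of permutations of $\{1,\dots,kd/2\}$, write $\pi(I)=(i_{\pi(1)},\dots,i_{\pi(kd/2)})$ for $I=(i_1,\dots,i_{kd/2})$, and define $$R^{\Phi,d}_{I,J}=\frac1{|\mathbb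 S_{kd/2}|^2}\sum_{\pi,\sigma\in\mathbb S_{kd/2}}S^{\Phi,d}_{\pi(I),\sigma(J)},\qquad I,J\in[n]^{kd/2},$$ the type-symmetric matrix representation of the $d$-th power of the polynomial $f^\Phi(x)=\sum_{S\in[n]^k} T_S\prod_{i=1}^k x_{s_i}$. \emph{Partitions.} For tuples $I_j\in[n]^{kd/2}$ and permutations $\pi_j,\sigma_j\in\mathbb S_{kd/2}$, $j=1,\dots,2\ell$ (with $I_{2\ell+1}=I_1$), let $A_{j,s}$ be the $s$-th block of $\pi_j(I_j)$ and $B_{j,s}$ the $s$-th block of $\sigma_j(I_{j+1})$. Let $\mathsf{Par}(\{I_j\},\{\pi_j\},\{\sigma_j\})$ be the partition of $\{1,\dots,2\ell\}\times\{1,\dots,d\}$ into the classes of the equivalence relation: $(j,s)\sim(j',s')$ if and only if $(A_{j,s},B_{j,s})$ equals $(A_{j',s'},B_{j',s'})$ or $(B_{j',s'},A_{j',s'})$. A partition $\mathcal Q$ of $\{1,\dots,2\ell\}\times\{1,\dots,d\}$ is \emph{even} if all its classes have even size, and $|\mathcal Q|$ is its number of classes. A collection $\{I_j\}_{j=1}^{2\ell}$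 is \emph{$\mathcal Q$-valid} if $\mathsf{Par}(\{I_j\},\{\mathrm{id}\},\{\sigma_j\})=\mathcal Q$ for some $\{\sigma_j\}$. Finally, $\mathsf{hist}(I)!=\prod_{i=1}^n\alpha_i!$, where $\alpha_i$ is the number of times $i$ occurs in $I$. \textbf{Theorem.} $$\mathbb E\,\mathrm{tr}\big((R^{\Phi,d})^{2\ell}\big)\le\frac1{|\mathbb S_{kd/2}|^{2\ell}}\sum_{\mathcal Q\text{ even}}\left[\Big(p\,(kd/2)^{k/2}\Big)^{|\mathcal Q|}\sum_{\{I_j\}\ \mathcal Q\text{-valid}}\ \prod_{j=1}^{2\ell}\mathsf{hist}(I_j)!\right].$$ (For $k=0$, $(kd/2)^{k/2}=0^0=1$.) -/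

import Mathlib

open MeasureTheory ProbabilityTheory Matrix

noncomputable section

namespace KXOR

/-! ### Random `k`-XOR -/

/-- A `k`-XOR instance `Φ` over `n` variables: to each `k`-tuple `S` it assigns at most one
constraint `∏ i, x (S i) = η`.  `Φ S = some η` means that this constraint is in `Φ`, and
`Φ S = none` means that there is no constraint on `S`. -/
abbrev Instance (k n : ℕ) : Type := (Fin k → Fin n) → Option ℤˣ

/-- The outcomes of the sampling procedure: for each `k`-tuple, whether it is sampled, and a
sign. -/
abbrev Outcome (k n : ℕ) : Type := ((Fin k → Fin n) → Bool) × ((Fin k → Fin n) → ℤˣ)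

/-- The Rademacher distribution: `1` and `-1` with probability `1/2` each. -/
def rademacher : Measure ℤˣ :=
  bernoulliMeasure (1 : ℤˣ) (-1) ⟨1 / 2, by norm_num, by norm_num⟩

/-- The law of the sampling procedure with probability `p`: every `k`-tuple is sampled
independently with probability `p`, and the signs are i.i.d. Rademacher, independent of the
sampled set. -/
def samplingLaw (k n : ℕ) (p : unitInterval) : Measure (Outcome k n) :=
  (Measure.pi fun _ : Fin k → Fin n => bernoulliMeasure true false p).prod
    (Measure.pi fun _ : Fin k → Fin n => rademacher)

/-- The instance produced by an outcome: for each sampled tuple `S`, the constraint with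
right-hand side `η S`. -/
def Outcome.toInstance {k n : ℕ} (ω : Outcome k n) : Instance k n :=
  fun S => if ω.1 S then some (ω.2 S) else none

/-! ### The constraints tensor and the matrices `S^Φ`, `S^{Φ,d}`, `R^{Φ,d}` -/

/-- The constraints tensor: the right-hand side of the constraint on `S` if there is one, and `0`
otherwise. -/
def constraintsTensor {k n : ℕ} (Φ : Instance k n) (S : Fin k → Fin n) : ℝ :=
  match Φ S with
  | none => 0
  | some η => ((η : ℤ) : ℝ)

/-- The `k`-tuple `(U, V)` formed from two `k/2`-tuples, for even `k`. -/
def concat {k n : ℕ} (hk : Even k) (U V : Fin (k / 2) → Fin n) : Fin k → Fin n :=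
  Fin.append U V ∘ Fin.cast (by obtain ⟨r, rfl⟩ := hk; omega)

/-- The natural `n^{k/2} × n^{k/2}` flattening of the constraints tensor. -/
def flattening {k n : ℕ} (hk : Even k) (Φ : Instance k n) :
    Matrix (Fin (k / 2) → Fin n) (Fin (k / 2) → Fin n) ℝ :=
  Matrix.of fun U V => constraintsTensor Φ (concat hk U V)

/-- The symmetric matrix representation `S^Φ`. -/
def symRep {k n : ℕ} (hk : Even k) (Φ : Instance k n) :
    Matrix (Fin (k / 2) → Fin n) (Fin (k / 2) → Fin n) ℝ :=
  (1 / 2 : ℝ) • (flattening hk Φ + (flattening hk Φ)ᵀ)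

/-- The `kd/2` positions of a `kd/2`-tuple: position `(s, t)` is the `t`-th place of the `s`-th of
`d` consecutive blocks of length `k/2`. -/
abbrev Pos (k d : ℕ) : Type := Fin d × Fin (k / 2)

/-- `kd/2`-tuples `I = (U_1, …, U_d)` with entries in `[n]`. -/
abbrev Tuple (k d n : ℕ) : Type := Pos k d → Fin n

/-- The `s`-th block `U_s` (a `k/2`-tuple) of `I = (U_1, …, U_d)`. -/
def block {k d n : ℕ} (I : Tuple k d n) (s : Fin d) : Fin (k / 2) → Fin n := fun t => I (s, t)

/-- `π(I)`, the tuple whose entry at the position `m` is the entry of `I` at `π m`. -/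
def permute {k d n : ℕ} (π : Equiv.Perm (Pos k d)) (I : Tuple k d n) : Tuple k d n :=
  fun m => I (π m)

/-- The `d`-th Kronecker power `S^{Φ,d}` of `S^Φ`. -/
def kroneckerPow {k n : ℕ} (hk : Even k) (d : ℕ) (Φ : Instance k n) :
    Matrix (Tuple k d n) (Tuple k d n) ℝ :=
  Matrix.of fun I J => ∏ s : Fin d, symRep hk Φ (block I s) (block J s)

/-- The higher-order (type-)symmetric matrix representation `R^{Φ,d}` of the `d`-th power of the
constraints polynomial. -/
def highRep {k n : ℕ} (hk : Even k) (d : ℕ) (Φ : Instance k n) :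
    Matrix (Tuple k d n) (Tuple k d n) ℝ :=
  Matrix.of fun I J =>
    1 / (Fintype.card (Equiv.Perm (Pos k d)) : ℝ) ^ 2 *
      ∑ π : Equiv.Perm (Pos k d), ∑ σ : Equiv.Perm (Pos k d),
        kroneckerPow hk d Φ (permute π I) (permute σ J)

/-! ### Histograms, partitions, validity -/

/-- The histogram of a tuple: the number of times that `i` appears in `I`. -/
def hist {k d n : ℕ} (I : Tuple k d n) (i : Fin n) : ℕ :=
  (Finset.univ.filter fun m => I m = i).card

/-- `hist(I)!`, the product of the factorials of the coordinates of the histogram. -/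
def histFactorial {k d n : ℕ} (I : Tuple k d n) : ℕ := ∏ i : Fin n, (hist I i).factorial

/-- The index set `{(j, s) : j = 1, …, 2ℓ, s = 1, …, d}`. -/
abbrev Idx (l d : ℕ) : Type := Fin (2 * l) × Fin d

/-- The block `π_j(U_{j,s})`. -/
def leftBlock {k d n l : ℕ} (I : Fin (2 * l) → Tuple k d n)
    (π : Fin (2 * l) → Equiv.Perm (Pos k d)) (a : Idx l d) : Fin (k / 2) → Fin n :=
  block (permute (π a.1) (I a.1)) a.2

/-- The block `σ_j(U_{j+1,s})`, where `j + 1` is read modulo `2ℓ`. -/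
def rightBlock {k d n l : ℕ} (I : Fin (2 * l) → Tuple k d n)
    (σ : Fin (2 * l) → Equiv.Perm (Pos k d)) (a : Idx l d) : Fin (k / 2) → Fin n :=
  block (permute (σ a.1) (I (finRotate (2 * l) a.1))) a.2

/-- The equivalence relation on the index set: the ordered pairs of blocks at the two indices
coincide, or coincide after swapping one of them. -/
def parSetoid {k d n l : ℕ} (I : Fin (2 * l) → Tuple k d n)
    (π σ : Fin (2 * l) → Equiv.Perm (Pos k d)) : Setoid (Idx l d) where
  r a b :=
    (leftBlock I π a, rightBlock I σ a) = (leftBlock I π b, rightBlock I σ b) ∨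
      (leftBlock I π a, rightBlock I σ a) = (rightBlock I σ b, leftBlock I π b)
  iseqv := by
    refine ⟨fun a => Or.inl rfl, ?_, ?_⟩
    · intro a b h
      simp only [Prod.mk.injEq] at h ⊢
      tauto
    · intro a b c h h'
      simp only [Prod.mk.injEq] at h h' ⊢
      rcases h with ⟨h1, h2⟩ | ⟨h1, h2⟩ <;> rw [h1, h2] <;> tauto

open Classical in
/-- `Par({I_j}, {π_j}, {σ_j})`, the partition of the index set into the equivalence classes. -/
def par {k d n l : ℕ} (I : Fin (2 * l) → Tuple k d n)
    (π σ : Fin (2 * l) → Equiv.Perm (Pos k d)) :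
    Finpartition (Finset.univ : Finset (Idx l d)) :=
  Finpartition.ofSetoid (parSetoid I π σ)

/-- A partition of the index set is even if all its classes have even size. -/
def IsEvenPartition {l d : ℕ} (Q : Finpartition (Finset.univ : Finset (Idx l d))) : Prop :=
  ∀ c ∈ Q.parts, Even c.card

/-- `{I_j}` is `Q`-valid if `Par({I_j}, {id}, {σ_j}) = Q` for some `{σ_j}`. -/
def IsValid {k d n l : ℕ} (Q : Finpartition (Finset.univ : Finset (Idx l d)))
    (I : Fin (2 * l) → Tuple k d n) : Prop :=
  ∃ σ : Fin (2 * l) → Equiv.Perm (Pos k d), par I (fun _ => Equiv.refl _) σ = Q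

end KXOR

end

namespace KXOR

/-! The trace is a sum over closed walks `I_1, …, I_{2ℓ}`, and each entry of `highRep` averages over
two permutations, so the expectation becomes a sum over `I`, `π`, `σ` of moments of `symRep`. Signs
with an odd exponent average to zero, and each distinct tuple that survives costs one factor `p`;
hence a moment is at most `p ^ |Par|`, and it is at most zero unless `Par` is even
(`integral_prod_symRep_le`).

Substituting `π_j(I_j)` for `I_j` removes the `π_j` and cancels half of the normalisation. What
remains is to count the `σ` with `Par = Q` (`card_par_eq_le`): the left blocks are fixed, so one
right block per class, chosen in at most `(kd/2)^{k/2}` ways, determines all right blocks, and each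
tuple `σ_j(I_{j+1})` comes from at most `hist(I_{j+1})!` permutations. -/

/-! ### The trace of a power as a sum over closed walks -/

theorem sum_path_eq_sum_pow {ι : Type*} [Fintype ι] [DecidableEq ι] (A : Matrix ι ι ℝ) (m : ℕ)
    (f : ι → ι → ℝ) :
    ∑ w : Fin (m + 1) → ι, (∏ t : Fin m, A (w t.castSucc) (w t.succ)) * f (w 0) (w (Fin.last m)) =
      ∑ i, ∑ j, (A ^ m) i j * f i j := by
  induction m generalizing f with
  | zero =>
    rw [← (Equiv.funUnique (Fin 1) ι).symm.sum_comp]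
    simp [Matrix.one_apply]
  | succ m ih =>
    rw [← (Fin.consEquiv fun _ => ι).sum_comp, Fintype.sum_prod_type]
    -- The weight on the endpoints is arbitrary, so it can absorb the first edge of the walk.
    have h := ih fun x y => ∑ i, A i x * f i y
    simp only [Finset.mul_sum] at h
    rw [Finset.sum_comm] at h
    simp only [Fin.consEquiv_apply, Fin.prod_univ_succ, Fin.cons_zero, Fin.cons_succ,
      Fin.castSucc_zero, ← Fin.succ_castSucc, ← Fin.succ_last]
    calc _ = _ := Finset.sum_congr rfl fun i _ => Finset.sum_congr rfl fun w _ => by ring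
      _ = _ := h
      _ = _ := by
        simp only [pow_succ', Matrix.mul_apply, Finset.sum_mul]
        rw [Finset.sum_congr rfl fun x _ => Finset.sum_comm, Finset.sum_comm]
        refine Finset.sum_congr rfl fun i _ => ?_
        rw [Finset.sum_comm]
        exact Finset.sum_congr rfl fun j _ => Finset.sum_congr rfl fun x _ => by ring

theorem trace_pow_eq_sum_prod {ι : Type*} [Fintype ι] [DecidableEq ι] (A : Matrix ι ι ℝ) {N : ℕ}
    (hN : N ≠ 0) :
    (A ^ N).trace = ∑ w : Fin N → ι, ∏ t, A (w t) (w (finRotate N t)) := by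
  obtain ⟨m, rfl⟩ := Nat.exists_eq_succ_of_ne_zero hN
  have h := sum_path_eq_sum_pow A m fun i j => A j i
  simp only [Nat.succ_eq_add_one, pow_succ, Matrix.trace, Matrix.diag, Matrix.mul_apply, ← h,
    Fin.prod_univ_castSucc, finRotate_last]
  refine Finset.sum_congr rfl fun w _ => ?_
  congr 1
  refine Finset.prod_congr rfl fun t _ => ?_
  congr 2
  exact (finRotate_of_lt t.2).symm

/-! ### Moments of the constraints tensor and of `symRep` -/

instance : IsProbabilityMeasure rademacher := by unfold rademacher; infer_instance

instance : MeasurableSingletonClass ℤˣ :=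
  ⟨fun x => ⟨{(x : ℤ)}, .of_discrete, by ext y; simp [Units.ext_iff]⟩⟩

instance (k n : ℕ) (p : unitInterval) : IsProbabilityMeasure (samplingLaw k n p) := by
  unfold samplingLaw; infer_instance

theorem constraintsTensor_toInstance {k n : ℕ} (ω : Outcome k n) (S : Fin k → Fin n) :
    constraintsTensor ω.toInstance S = (if ω.1 S then 1 else 0) * ((ω.2 S : ℤ) : ℝ) := by
  unfold constraintsTensor Outcome.toInstance
  cases ω.1 S <;> simp

theorem integral_indicator_pow (p : unitInterval) (m : ℕ) :
    ∫ b, (if b then (1 : ℝ) else 0) ^ m ∂bernoulliMeasure true false p =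
      if m = 0 then 1 else (p : ℝ) := by
  rw [integral_bernoulliMeasure]
  rcases eq_or_ne m 0 with rfl | h <;> simp [*]

theorem integral_rademacher_pow (m : ℕ) :
    ∫ u : ℤˣ, (((u : ℤ) : ℝ)) ^ m ∂rademacher = if Even m then 1 else 0 := by
  rw [rademacher, integral_bernoulliMeasure]
  rcases Nat.even_or_odd m with h | h
  · simp [h]
  · simp [h.neg_one_pow, Nat.not_even_iff_odd.2 h]; norm_num

theorem integral_prod_constraintsTensor {k n : ℕ} (p : unitInterval) {α : Type*} [Fintype α]
    (S : α → Fin k → Fin n) :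
    ∫ ω, ∏ a, constraintsTensor (Outcome.toInstance ω) (S a) ∂samplingLaw k n p =
      ∏ T, ((if (Finset.univ.filter fun a => S a = T).card = 0 then 1 else (p : ℝ)) *
        if Even (Finset.univ.filter fun a => S a = T).card then 1 else 0) := by
  have h (ω : Outcome k n) : ∏ a, constraintsTensor (Outcome.toInstance ω) (S a) =
      (∏ T, (if ω.1 T then (1 : ℝ) else 0) ^ (Finset.univ.filter fun a => S a = T).card) *
        ∏ T, ((ω.2 T : ℤ) : ℝ) ^ (Finset.univ.filter fun a => S a = T).card := by
    rw [← Finset.prod_mul_distrib, ← Finset.prod_fiberwise' Finset.univ S]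
    simp only [Finset.prod_const, constraintsTensor_toInstance, mul_pow]
  simp only [h]
  rw [samplingLaw, integral_prod_mul
    (fun x : (Fin k → Fin n) → Bool => ∏ T, (if x T then (1 : ℝ) else 0) ^
      (Finset.univ.filter fun a => S a = T).card)
    (fun y : (Fin k → Fin n) → ℤˣ => ∏ T, ((y T : ℤ) : ℝ) ^
      (Finset.univ.filter fun a => S a = T).card),
    integral_fintype_prod_eq_prod fun T (b : Bool) => (if b then (1 : ℝ) else 0) ^
      (Finset.univ.filter fun a => S a = T).card,
    integral_fintype_prod_eq_prod fun T (u : ℤˣ) => ((u : ℤ) : ℝ) ^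
      (Finset.univ.filter fun a => S a = T).card, ← Finset.prod_mul_distrib]
  simp only [integral_indicator_pow, integral_rademacher_pow]

open Classical in
-- By `hQ` each class of `Q` is a union of fibres of `S`. So even fibres force even classes, and
-- there are at least as many distinct tuples as classes; since `p ≤ 1`, passing to the smaller
-- exponent only increases the bound.
theorem integral_prod_constraintsTensor_le {k n : ℕ} (p : unitInterval) {α : Type*} [Fintype α]
    [DecidableEq α] (S : α → Fin k → Fin n) (Q : Finpartition (Finset.univ : Finset α))
    (hQ : ∀ c ∈ Q.parts, ∀ a b, S a = S b → a ∈ c → b ∈ c) :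
    ∫ ω, ∏ a, constraintsTensor (Outcome.toInstance ω) (S a) ∂samplingLaw k n p ≤
      if ∀ c ∈ Q.parts, Even c.card then (p : ℝ) ^ Q.parts.card else 0 := by
  rw [integral_prod_constraintsTensor]
  by_cases hS : ∀ T, Even (Finset.univ.filter fun a => S a = T).card
  · rw [if_pos]
    · calc _ = ∏ T : Fin k → Fin n, if T ∈ Finset.univ.image S then (p : ℝ) else 1 := by
            refine Finset.prod_congr rfl fun T _ => ?_
            rw [if_pos (hS T), mul_one]
            by_cases hT : T ∈ Finset.univ.image S
            · rw [if_pos hT, if_neg]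
              simpa [Finset.filter_eq_empty_iff] using hT
            · rw [if_neg hT, if_pos]
              simpa [Finset.filter_eq_empty_iff] using hT
        _ = (p : ℝ) ^ (Finset.univ.image S).card := by
            rw [Finset.prod_ite_mem, Finset.univ_inter, Finset.prod_const]
        _ ≤ _ := by
            refine pow_le_pow_of_le_one p.2.1 p.2.2 ?_
            -- Representatives of different classes carry different tuples.
            choose r hr using fun c : Q.parts => Q.nonempty_of_mem_parts c.2
            rw [← Finset.card_attach]
            refine Finset.card_le_card_of_injOn (fun c => S (r c)) (fun c _ => by simp) ?_
            intro c _ c' _ h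
            exact Subtype.ext (Q.eq_of_mem_parts c.2 c'.2 (hQ c c.2 _ _ h (hr c)) (hr c'))
    · intro c hc
      rw [Finset.card_eq_sum_card_image S]
      refine Finset.even_sum _ fun T hT => ?_
      obtain ⟨a, ha, rfl⟩ := Finset.mem_image.1 hT
      have h : c.filter (S · = S a) = Finset.univ.filter (S · = S a) := by
        ext b
        simp only [Finset.mem_filter, Finset.mem_univ, true_and, and_iff_right_iff_imp]
        exact fun h => hQ c hc _ _ h.symm ha
      rw [h]
      convert hS (S a)
  · push Not at hS
    obtain ⟨T, hT⟩ := hS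
    rw [Finset.prod_eq_zero (Finset.mem_univ T)]
    · have := p.2.1
      split_ifs <;> positivity
    · rw [if_neg hT, mul_zero]

theorem concat_injective {k n : ℕ} (hk : Even k) {U V U' V' : Fin (k / 2) → Fin n}
    (h : concat hk U V = concat hk U' V') : U = U' ∧ V = V' := by
  have h2 : k / 2 + k / 2 = k := by obtain ⟨r, rfl⟩ := hk; omega
  have h' : Fin.append U V = Fin.append U' V' := by
    ext x
    simpa [concat] using congrArg Fin.val (congrFun h (Fin.cast h2 x))
  constructor
  · ext x; simpa using congrArg Fin.val (congrFun h' (Fin.castAdd _ x))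
  · ext x; simpa only [Fin.append_right] using congrArg Fin.val (congrFun h' (Fin.natAdd _ x))

theorem symRep_apply {k n : ℕ} (hk : Even k) (Φ : Instance k n) (U V : Fin (k / 2) → Fin n) :
    symRep hk Φ U V =
      (1 / 2) * ∑ b : Bool, constraintsTensor Φ (if b then concat hk U V else concat hk V U) := by
  simp [symRep, flattening]

open Classical in
-- The product is an average over the orientations of all pairs `(U a, V a)`. Equal oriented tuples
-- come from pairs that agree up to a swap, so the previous bound applies to every orientation.
theorem integral_prod_symRep_le {k n : ℕ} (hk : Even k) (p : unitInterval) {α : Type*}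
    [Fintype α] [DecidableEq α] (U V : α → Fin (k / 2) → Fin n)
    (Q : Finpartition (Finset.univ : Finset α))
    (hQ : ∀ c ∈ Q.parts, ∀ a b, (U a = U b ∧ V a = V b ∨ U a = V b ∧ V a = U b) → a ∈ c → b ∈ c) :
    ∫ ω, ∏ a, symRep hk (Outcome.toInstance ω) (U a) (V a) ∂samplingLaw k n p ≤
      if ∀ c ∈ Q.parts, Even c.card then (p : ℝ) ^ Q.parts.card else 0 := by
  simp only [symRep_apply, Finset.prod_mul_distrib, Finset.prod_univ_sum, Finset.prod_const,
    Fintype.piFinset_univ]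
  rw [integral_const_mul, integral_finsetSum _ fun _ _ => .of_finite]
  refine (mul_le_mul_of_nonneg_left (Finset.sum_le_card_nsmul _ _ _ fun τ _ =>
    integral_prod_constraintsTensor_le p _ Q fun c hc a b hab => hQ c hc a b ?_)
    (by positivity)).trans_eq ?_
  · split_ifs at hab <;> have := concat_injective hk hab <;> tauto
  · rw [nsmul_eq_mul, ← mul_assoc]
    simp

/-! ### Counting the permutations that realise a given partition -/

theorem mem_iff_of_mem_par {k d n l : ℕ} {I : Fin (2 * l) → Tuple k d n}
    {π σ : Fin (2 * l) → Equiv.Perm (Pos k d)} {c : Finset (Idx l d)}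
    (hc : c ∈ (par I π σ).parts) {a b : Idx l d} (ha : a ∈ c) :
    b ∈ c ↔ parSetoid I π σ a b := by
  classical
  unfold par at hc
  rw [← Finpartition.mem_part_ofSetoid_iff_rel, Finpartition.part_eq_of_mem _ hc ha]

theorem par_congr {k d n l : ℕ} {I I' : Fin (2 * l) → Tuple k d n}
    {π σ π' σ' : Fin (2 * l) → Equiv.Perm (Pos k d)}
    (h : parSetoid I π σ = parSetoid I' π' σ') : par I π σ = par I' π' σ' := by
  unfold par
  congr!

/-- These `σ` lie in one coset of the stabilizer of `I`, whose order is the product of the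
factorials of the fibre sizes. -/
theorem card_permute_eq_le {k d n : ℕ} (I : Tuple k d n) (σ₀ : Equiv.Perm (Pos k d)) :
    (Finset.univ.filter fun σ => permute σ I = permute σ₀ I).card ≤ histFactorial I := by
  classical
  have h := DomMulAct.stabilizer_card I
  have h' : ∏ i, (Fintype.card {a // I a = i}).factorial = histFactorial I :=
    Finset.prod_congr rfl fun i _ => by rw [hist, Fintype.card_subtype]
  rw [← h', ← h, Fintype.card_subtype]
  refine Finset.card_le_card_of_injOn (fun σ => σ * σ₀⁻¹) (fun σ hσ => ?_)
    fun _ _ _ _ h => mul_right_cancel h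
  simp only [Finset.coe_filter, Finset.mem_univ, true_and, Set.mem_ofPred_eq] at hσ ⊢
  funext m
  have := congrFun hσ (σ₀⁻¹ m)
  simpa [permute] using this

/-- The orientation of the match may differ between `σ` and `σ'`, but then the left and right blocks
involved all coincide. -/
theorem rightBlock_eq_of_parSetoid {k d n l : ℕ} {I : Fin (2 * l) → Tuple k d n}
    {π σ σ' : Fin (2 * l) → Equiv.Perm (Pos k d)} {a b : Idx l d}
    (h : parSetoid I π σ a b) (h' : parSetoid I π σ' a b)
    (ha : rightBlock I σ a = rightBlock I σ' a) : rightBlock I σ b = rightBlock I σ' b := by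
  change _ ∨ _ at h h'
  simp only [Prod.mk.injEq] at h h'
  grind

open Classical in
theorem card_par_eq_le {k d n l : ℕ} (I : Fin (2 * l) → Tuple k d n)
    (π : Fin (2 * l) → Equiv.Perm (Pos k d))
    (Q : Finpartition (Finset.univ : Finset (Idx l d))) :
    (Finset.univ.filter fun σ => par I π σ = Q).card ≤
      (∏ j, histFactorial (I j)) * ((d * (k / 2)) ^ (k / 2)) ^ Q.parts.card := by
  choose r hr using fun c : Q.parts => Q.nonempty_of_mem_parts c.2
  -- The code records which positions `σ` reads at the representative of each class.
  let code (σ : Fin (2 * l) → Equiv.Perm (Pos k d)) (c : Q.parts) (t : Fin (k / 2)) : Pos k d :=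
    σ (r c).1 ((r c).2, t)
  refine (Finset.card_le_mul_card_image (f := code) _ (∏ j, histFactorial (I j)) ?_).trans
    (Nat.mul_le_mul_left _ ((Finset.card_le_univ _).trans_eq (by simp)))
  intro x hx
  obtain ⟨σ₀, h₀, rfl⟩ := Finset.mem_image.1 hx
  rw [Finset.mem_filter] at h₀
  -- `σ_j` acts on `I_{j+1}`, so the product is shifted cyclically.
  rw [← Equiv.prod_comp (finRotate (2 * l)) fun j => histFactorial (I j)]
  calc _ ≤ (Fintype.piFinset fun j => Finset.univ.filter fun σ =>
          permute σ (I (finRotate (2 * l) j)) = permute (σ₀ j) (I (finRotate (2 * l) j))).card := by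
        refine Finset.card_le_card fun σ hσ => ?_
        simp only [Finset.mem_filter, Finset.mem_univ, true_and] at hσ
        simp only [Fintype.mem_piFinset, Finset.mem_filter, Finset.mem_univ, true_and]
        have key (b : Idx l d) : rightBlock I σ b = rightBlock I σ₀ b := by
          obtain ⟨c, hc, hb⟩ := Q.exists_mem (Finset.mem_univ b)
          refine rightBlock_eq_of_parSetoid (π := π) (a := r ⟨c, hc⟩)
            ((mem_iff_of_mem_par (hσ.1 ▸ hc) (hr ⟨c, hc⟩)).1 hb)
            ((mem_iff_of_mem_par (h₀.2 ▸ hc) (hr ⟨c, hc⟩)).1 hb) ?_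
          funext t
          exact congrArg (I _) (congrFun (congrFun hσ.2 ⟨c, hc⟩) t)
        intro j
        funext m
        exact congrFun (key (j, m.1)) m.2
    _ = _ := Fintype.card_piFinset _
    _ ≤ _ := Finset.prod_le_prod' fun j _ => card_permute_eq_le _ _

/-- Replacing each `I j` by `permute (π j) (I j)` reduces all left permutations to the identity. -/
theorem sum_par_eq_sum_par_refl {k d n l : ℕ}
    (F : Finpartition (Finset.univ : Finset (Idx l d)) → ℝ) :
    ∑ I : Fin (2 * l) → Tuple k d n, ∑ π, ∑ σ, F (par I π σ) =
      (Fintype.card (Equiv.Perm (Pos k d)) : ℝ) ^ (2 * l) *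
        ∑ I : Fin (2 * l) → Tuple k d n, ∑ σ, F (par I (fun _ => Equiv.refl _) σ) := by
  have h (π : Fin (2 * l) → Equiv.Perm (Pos k d)) :
      ∑ I : Fin (2 * l) → Tuple k d n, ∑ σ, F (par I π σ) =
        ∑ I : Fin (2 * l) → Tuple k d n, ∑ σ, F (par I (fun _ => Equiv.refl _) σ) := by
    -- To leave the right blocks unchanged, `σ_j` is replaced by `π_{j+1}⁻¹ σ_j`.
    refine Fintype.sum_equiv (Equiv.piCongrRight fun j => (π j).symm.arrowCongr (Equiv.refl _)) _ _
      fun I => Fintype.sum_equiv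
        (Equiv.piCongrRight fun j => Equiv.mulLeft (π (finRotate (2 * l) j))⁻¹) _ _ fun σ => ?_
    refine congrArg F (par_congr ?_)
    ext a b
    change _ ∨ _ ↔ _ ∨ _
    simp [leftBlock, rightBlock, block, permute, funext_iff]
  rw [Finset.sum_comm]
  simp only [h, Finset.sum_const, nsmul_eq_mul, Finset.card_univ, Fintype.card_pi_const,
    Nat.cast_pow]

/-! ### Assembling the bound -/

open Classical in
theorem integral_prod_kroneckerPow_le {k d n l : ℕ} (hk : Even k) (p : unitInterval)
    (I : Fin (2 * l) → Tuple k d n) (π σ : Fin (2 * l) → Equiv.Perm (Pos k d)) :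
    ∫ ω, ∏ j, kroneckerPow hk d (Outcome.toInstance ω) (permute (π j) (I j))
        (permute (σ j) (I (finRotate (2 * l) j))) ∂samplingLaw k n p ≤
      if IsEvenPartition (par I π σ) then (p : ℝ) ^ (par I π σ).parts.card else 0 := by
  have h := integral_prod_symRep_le hk p (leftBlock I π) (rightBlock I σ) (par I π σ) ?_
  · simp only [Fintype.prod_prod_type] at h
    convert h
    · rfl
    · rfl
  · intro c hc a b hab ha
    refine (mem_iff_of_mem_par hc ha).2 ?_
    change _ ∨ _
    simpa only [Prod.mk.injEq] using hab

theorem prod_highRep_eq {k d n l : ℕ} (hk : Even k) (Φ : Instance k n)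
    (I : Fin (2 * l) → Tuple k d n) :
    ∏ j, highRep hk d Φ (I j) (I (finRotate (2 * l) j)) =
      (1 / (Fintype.card (Equiv.Perm (Pos k d)) : ℝ) ^ 2) ^ (2 * l) *
        ∑ π : Fin (2 * l) → Equiv.Perm (Pos k d), ∑ σ : Fin (2 * l) → Equiv.Perm (Pos k d),
          ∏ j, kroneckerPow hk d Φ (permute (π j) (I j))
            (permute (σ j) (I (finRotate (2 * l) j))) := by
  simp [highRep, Finset.prod_mul_distrib, Finset.prod_univ_sum]

open Classical in
theorem sum_par_refl_le {k d n l : ℕ} (hk : Even k) (p : unitInterval)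
    (I : Fin (2 * l) → Tuple k d n) :
    (∑ σ, if IsEvenPartition (par I (fun _ => Equiv.refl _) σ) then
        (p : ℝ) ^ (par I (fun _ => Equiv.refl _) σ).parts.card else 0) ≤
      ∑ Q : Finpartition (Finset.univ : Finset (Idx l d)) with IsEvenPartition Q,
        ((p : ℝ) * ((k : ℝ) * d / 2) ^ (k / 2)) ^ Q.parts.card *
          if IsValid Q I then ∏ j, (histFactorial (I j) : ℝ) else 0 := by
  have hD : (k : ℝ) * d / 2 = ((d * (k / 2) : ℕ) : ℝ) := by
    obtain ⟨r, rfl⟩ := hk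
    rw [← two_mul, Nat.mul_div_cancel_left _ two_pos]
    push_cast
    ring
  rw [← Finset.sum_fiberwise Finset.univ (par I fun _ => Equiv.refl _), Finset.sum_filter]
  refine Finset.sum_le_sum fun Q _ => ?_
  rw [Finset.sum_congr rfl (g := fun _ =>
    if IsEvenPartition Q then (p : ℝ) ^ Q.parts.card else 0)
    fun σ hσ => by rw [(Finset.mem_filter.1 hσ).2], Finset.sum_const, nsmul_eq_mul]
  split_ifs with hQ hv
  · have h : (_ : ℝ) ≤ _ := Nat.cast_le.2 (card_par_eq_le I (fun _ => Equiv.refl _) Q)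
    rw [hD]
    refine (mul_le_mul_of_nonneg_right h (pow_nonneg p.2.1 _)).trans_eq ?_
    push_cast
    ring
  · rw [Finset.filter_false_of_mem fun σ _ h => hv ⟨σ, h⟩]
    simp
  · simp

end KXOR
open KXOR in
open Classical in
theorem mainTheorem3 (k d n l : ℕ) (hk : Even k) (hd : 1 ≤ d) (hl : 1 ≤ l) (p : unitInterval) :
    ∫ ω, ((highRep hk d (Outcome.toInstance ω)) ^ (2 * l)).trace ∂(samplingLaw k n p) ≤
      1 / (Fintype.card (Equiv.Perm (Pos k d)) : ℝ) ^ (2 * l) *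
        ∑ Q : Finpartition (Finset.univ : Finset (Idx l d)) with IsEvenPartition Q,
          ((p : ℝ) * ((k : ℝ) * d / 2) ^ (k / 2)) ^ Q.parts.card *
            ∑ I : Fin (2 * l) → Tuple k d n with IsValid Q I,
              ∏ j, (histFactorial (I j) : ℝ) := by
  have hM : (Fintype.card (Equiv.Perm (Pos k d)) : ℝ) ≠ 0 :=
    Nat.cast_ne_zero.2 Fintype.card_ne_zero
  simp only [trace_pow_eq_sum_prod _ (by omega : 2 * l ≠ 0), prod_highRep_eq, ← Finset.mul_sum]
  rw [integral_const_mul, integral_finsetSum _ fun _ _ => .of_finite]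
  simp only [integral_finsetSum _ fun _ _ => Integrable.of_finite]
  calc _ ≤ (1 / (Fintype.card (Equiv.Perm (Pos k d)) : ℝ) ^ 2) ^ (2 * l) *
        ∑ I : Fin (2 * l) → Tuple k d n, ∑ π, ∑ σ,
          if IsEvenPartition (par I π σ) then (p : ℝ) ^ (par I π σ).parts.card else 0 := by
        gcongr
        exact integral_prod_kroneckerPow_le hk p _ _ _
    _ = 1 / (Fintype.card (Equiv.Perm (Pos k d)) : ℝ) ^ (2 * l) *
        ∑ I : Fin (2 * l) → Tuple k d n, ∑ σ,
          if IsEvenPartition (par I (fun _ => Equiv.refl _) σ) then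
            (p : ℝ) ^ (par I (fun _ => Equiv.refl _) σ).parts.card else 0 := by
        rw [sum_par_eq_sum_par_refl fun Q =>
          if IsEvenPartition Q then (p : ℝ) ^ Q.parts.card else 0, ← mul_assoc]
        have h : 1 / (Fintype.card (Equiv.Perm (Pos k d)) : ℝ) ^ 2 *
            Fintype.card (Equiv.Perm (Pos k d)) = 1 / Fintype.card (Equiv.Perm (Pos k d)) := by
          field_simp
        rw [← mul_pow, h, _root_.one_div_pow]
    _ ≤ _ := by
        gcongr
        refine (Finset.sum_le_sum fun I _ => sum_par_refl_le hk p I).trans_eq ?_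
        rw [Finset.sum_comm]
        simp only [← Finset.mul_sum, Finset.sum_filter]
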